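/- Let $\mathcal X$ be a measurable space, $P$ a probability distribution on $\mathcal X\times\mathbb R$, and $\mathcal A$ a regression algorithm: for every $k\ge 0$ it maps a data set $D\in(\mathcal X\times\mathbb R)^k$ to a function $\mathcal A(D):\mathcal X\to\mathbb R$, such that $(D,x)\mapsto\mathcal A(D)(x)$ is measurable for each $k$. Assume that $\mathcal A$ is symmetric, i.e. $\mathcal A(D)$ does not depend on the order of the data points in $D$. For real numbers $v_1,\dots,v_n$ and $\tau\in\mathbb R$ let $$\mathrm{Quantile}(\{v_i\}_{i\in[n]};\tau)=\inf\Big\{t\in\mathbb R:\ \tfrac1n\#\{i\in[n]:v_i\le t\}\ge\tau\Big\}\in[-\infty,+\infty],\qquad \inf\emptyset=+\infty.$$ For $n\ge1$, $m\ge0$ define the in-sample $m$-stability $$\beta^{\mathrm{in}}_{m,n}(\mathcal A,P)=\mathbb E\big[\,|\widehat\mu_n(X_1)-\widehat\mu_{n+m}(X_1)|\,\big]\in[0,\infty],$$ where $(X_1,Y_1),\dots,(X_{n+m},Y_{n+m})$ are i.i.d. from $P$ and $\widehat\mu_k=\mathcal A((X_1,Y_1),\dots,(X_k,Y_k))$.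 Theorem. Let $\alpha\in[0,1]$, $n\ge1$ and $\gamma>0$. For training data $\mathcal D_n=\{(X_i,Y_i)\}_{i\in[n]}$, $x\in\mathcal X$ and $y\in\mathbb R$ put $\widehat\mu^{y}=\mathcal A((X_1,Y_1),\dots,(X_n,Y_n),(x,y))$, define the $\gamma$-inflated full conformal prediction set $$\widehat C_n^{\gamma\text{-CP}}(x)=\Big\{y\in\mathbb R:\ |y-\widehat\mu^{y}(x)|\le \mathrm{Quantile}\big(\{|Y_i-\widehat\mu^{y}(X_i)|\}_{i\in[n]};(1-\alpha)(1+1/n)\big)+\gamma\Big\},$$ and let $$\alpha_P^{\gamma\text{-CP}}(\mathcal D_n)=\mathbb P\big\{Y_{n+1}\notin\widehat C_n^{\gamma\text{-CP}}(X_{n+1})\ \big|\ \mathcal D_n\big\}$$ be its training-conditional miscoverage rate, where $(X_{n+1},Y_{n+1})\sim P$ is independent of $\mathcal D_n$. Then for all $m\ge1$ and $\delta\in(0,1)$, $$\mathbb P\left\{\alpha_P^{\gamma\text{-CP}}(\mathcal D_n)<\alpha+3\sqrt{\frac{\log(1/\delta)}{2\min\{n,m\}}}+2\sqrt[3]{\frac{2\beta^{\mathrm{in}}_{m-1,n+1}(\mathcal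 A,P)}{\gamma}}\right\}\ \ge\ 1-3\delta-\sqrt[3]{\frac{2\beta^{\mathrm{in}}_{m-1,n+1}(\mathcal A,P)}{\gamma}},$$ where the probability is over $(X_1,Y_1),\dots,(X_n,Y_n)$ i.i.d. from $P$. (If $\beta^{\mathrm{in}}_{m-1,n+1}(\mathcal A,P)=+\infty$ the claim is void.) -/

import Mathlib

open MeasureTheory
open scoped ENNReal

/-- A regression algorithm `𝒜`: it takes a data set of any size `k` (a `k`-tuple of pairs
`(x, y)`) and returns a fitted regression function `𝓧 → ℝ`. The prediction is jointly measurable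
in the data set and the test point; in particular every fitted function is measurable. -/
structure RegressionAlgorithm (𝓧 : Type*) [MeasurableSpace 𝓧] where
  /-- `fit k D x` is the prediction at `x` of the model fitted to the data set `D` of size `k`. -/
  fit : (k : ℕ) → (Fin k → 𝓧 × ℝ) → 𝓧 → ℝ
  measurable_fit : ∀ k : ℕ, Measurable fun p : (Fin k → 𝓧 × ℝ) × 𝓧 => fit k p.1 p.2

/-- The algorithm is symmetric: the order of the data points is irrelevant. -/
def RegressionAlgorithm.IsSymmetric {𝓧 : Type*} [MeasurableSpace 𝓧]
    (A : RegressionAlgorithm 𝓧) : Prop :=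
  ∀ (k : ℕ) (π : Equiv.Perm (Fin k)) (D : Fin k → 𝓧 × ℝ), A.fit k (fun i => D (π i)) = A.fit k D

/-- The `τ`-quantile `inf {t : (1/n) #{i : v i ≤ t} ≥ τ}` of the values `v 1, …, v n`, as an
extended real number: it is `+∞` for `τ > 1` (empty infimum) and `-∞` for `τ ≤ 0`. -/
noncomputable def quantile {n : ℕ} (v : Fin n → ℝ) (τ : ℝ) : EReal :=
  sInf ((fun t : ℝ => (t : EReal)) ''
    {t : ℝ | τ * n ≤ ((Finset.univ.filter fun i => v i ≤ t).card : ℝ)})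

/-- `μ̂^y`: the model fitted to the training data `D` together with the hypothesized test
point `(x, y)`. -/
noncomputable def augmentedModel {𝓧 : Type*} [MeasurableSpace 𝓧] (A : RegressionAlgorithm 𝓧)
    {n : ℕ} (D : Fin n → 𝓧 × ℝ) (x : 𝓧) (y : ℝ) : 𝓧 → ℝ :=
  A.fit (n + 1) (Fin.snoc (α := fun _ => 𝓧 × ℝ) D (x, y))

/-- The `γ`-inflated full conformal prediction set at the test point `x`, with training
data `D`. -/
noncomputable def conformalSet {𝓧 : Type*} [MeasurableSpace 𝓧] (A : RegressionAlgorithm 𝓧)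
    (α γ : ℝ) {n : ℕ} (D : Fin n → 𝓧 × ℝ) (x : 𝓧) : Set ℝ :=
  {y : ℝ | ((|y - augmentedModel A D x y x| : ℝ) : EReal) ≤
    quantile (fun i => |(D i).2 - augmentedModel A D x y (D i).1|)
      ((1 - α) * (1 + 1 / (n : ℝ))) + (γ : EReal)}

/-- The training-conditional miscoverage rate, as a function of the training data `D`: the
probability that the set built from `D` misses the response of a new point `(X, Y) ∼ P`
(independent of the training data). -/
noncomputable def miscoverage {𝓧 : Type*} [MeasurableSpace 𝓧] (A : RegressionAlgorithm 𝓧)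
    (P : Measure (𝓧 × ℝ)) (α γ : ℝ) {n : ℕ} (D : Fin n → 𝓧 × ℝ) : ℝ≥0∞ :=
  P {z : 𝓧 × ℝ | z.2 ∉ conformalSet A α γ D z.1}

/-- In-sample `m`-stability `E |μ̂_n(X_1) - μ̂_{n+m}(X_1)|` for `n ≥ 1`, where the `n + m` data
points are i.i.d. from `P`, and `μ̂_n`, `μ̂_{n+m}` are fitted to the first `n` and to all of them.
The expectation of this nonnegative variable may be `+∞`. -/
noncomputable def inSampleStability {𝓧 : Type*} [MeasurableSpace 𝓧] (A : RegressionAlgorithm 𝓧)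
    (P : Measure (𝓧 × ℝ)) (m n : ℕ) [NeZero n] : ℝ≥0∞ :=
  ∫⁻ D : Fin (n + m) → 𝓧 × ℝ,
    ENNReal.ofReal |A.fit n (fun i => D (Fin.castAdd m i)) (D (Fin.castAdd m 0)).1
      - A.fit (n + m) D (D (Fin.castAdd m 0)).1|
    ∂(Measure.pi fun _ => P)

/-! Imagine `m` further test points (in the lemmas `m + 1`), so that `N = n + m` i.i.d. points are
available, and let `R` be the residuals of the model fitted to all `N`. By symmetry the ranks of `R`
are exchangeable between training and test points, whereas the conformal set uses a different model,
fitted to the training data and one test point. Stability links the two.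

Write `ρ` for the cube root of `2β/γ` and `t` for the square root in the bound. If a test point is
miscovered, its `n + 1`-point residual exceeds at least `(1 - α)(n + 1)` training residuals by more
than `γ`. Suppose the two models differ by at most `γ/2` at this test point and at all but a
fraction `ρ` of the `n + 1` points. Then its `R` exceeds at least `(1 - α - ρ)(n + 1)` training
values (`le_card_residual_lt`). Hoeffding's inequality without replacement
(`measure_card_filter_embedding_ge_le`) shows that fewer than `(1 - α - ρ)n` training points have
low overall rank, so the test point beats one that does not and has high rank itself. By the same
inequality few test points have high rank. Hence few test points are miscovered, and Hoeffding's
inequality given the training data turns their frequency into the conditional probability.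

The cube root comes from three uses of Markov's inequality: instability at one point has probability
at most `ρ ^ 3`, a bad test point at most `ρ ^ 2`, and more than a fraction `ρ` of bad test points
at most `ρ`. The three Hoeffding bounds cost `δ` each. -/

/-! ### Chernoff bounds from joint probabilities -/

/-- Hoeffding's lemma for a Bernoulli variable, with `1 - p + p * exp s` written out. -/
theorem one_add_mul_exp_sub_one_le {p : ℝ} (hp0 : 0 ≤ p) (hp1 : p ≤ 1) (s : ℝ) :
    1 + p * (Real.exp s - 1) ≤ Real.exp (s * p + s ^ 2 / 8) := by
  -- The Bernoulli law with mean `p`: Hoeffding's lemma for variables in `[0, 1]` bounds its centred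
  -- moment generating function by `exp (s ^ 2 / 8)`.
  let ν : Measure ℝ :=
    ENNReal.ofReal p • Measure.dirac 1 + ENNReal.ofReal (1 - p) • Measure.dirac 0
  have hν : IsProbabilityMeasure ν := by
    constructor
    simp only [ν, Measure.coe_add, Measure.coe_smul, Pi.add_apply, Pi.smul_apply, measure_univ,
      smul_eq_mul, mul_one]
    rw [← ENNReal.ofReal_add hp0 (by linarith)]
    simp
  have hint : ∀ f : ℝ → ℝ, ∫ x, f x ∂ν = p * f 1 + (1 - p) * f 0 := by
    intro f
    have h : ∀ (c : ℝ) (a : ℝ), Integrable f (ENNReal.ofReal c • Measure.dirac a) := fun c a =>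
      (integrable_dirac (by finiteness)).smul_measure ENNReal.ofReal_ne_top
    rw [integral_add_measure (h _ _) (h _ _), integral_smul_measure, integral_smul_measure,
      integral_dirac, integral_dirac, ENNReal.toReal_ofReal hp0,
      ENNReal.toReal_ofReal (by linarith)]
    simp
  have hmem : ∀ᵐ x ∂ν, id x ∈ Set.Icc (0 : ℝ) 1 := by
    refine ae_iff.2 ?_
    simp [ν]
  have h := (ProbabilityTheory.hasSubgaussianMGF_of_mem_Icc (μ := ν) (X := id)
    measurable_id.aemeasurable hmem).mgf_le s
  rw [ProbabilityTheory.mgf, hint, hint] at h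
  simp only [id, mul_one, mul_zero, add_zero, zero_sub, sub_zero] at h
  have e1 : p * Real.exp (s * (1 - p)) + (1 - p) * Real.exp (s * -p)
      = (1 + p * (Real.exp s - 1)) * Real.exp (-(s * p)) := by
    rw [mul_sub, sub_eq_add_neg (s * 1), Real.exp_add, mul_neg, mul_one]
    ring
  rw [e1] at h
  have h2 := mul_le_mul_of_nonneg_right h (Real.exp_pos (s * p)).le
  rw [mul_assoc, ← Real.exp_add, ← Real.exp_add] at h2
  simp only [neg_add_cancel, Real.exp_zero, mul_one] at h2
  refine h2.trans_eq ?_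
  congr 1
  norm_num
  ring

/-- A Chernoff–Hoeffding bound for the number of events that occur, when the probability that all
events of a subfamily occur is at most what it would be for independent events of
probability `p`. -/
theorem measure_card_filter_ge_le {Ω ι : Type*} [MeasurableSpace Ω] {μ : Measure Ω}
    [Fintype ι] (B : ι → Set Ω) [∀ ω, DecidablePred fun i => ω ∈ B i]
    (hB : ∀ i, MeasurableSet (B i)) {p t : ℝ} (hp0 : 0 ≤ p) (hp1 : p ≤ 1) (ht : 0 ≤ t)
    (h : ∀ T : Finset ι, μ (⋂ i ∈ T, B i) ≤ ENNReal.ofReal (p ^ T.card)) :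
    μ {ω | (p + t) * Fintype.card ι ≤ ((Finset.univ.filter fun i => ω ∈ B i).card : ℝ)}
      ≤ ENNReal.ofReal (Real.exp (-(2 * Fintype.card ι * t ^ 2))) := by
  classical
  -- This minimizes the Chernoff exponent `s ^ 2 / 8 - s * t`, with minimum `-2 * t ^ 2`.
  set s : ℝ := 4 * t with hs
  have hs0 : 0 ≤ s := by positivity
  have hx0 : 0 ≤ Real.exp s - 1 := by linarith [Real.add_one_le_exp s]
  set x : ℝ := Real.exp s - 1 with hx
  set N : ℕ := Fintype.card ι with hN
  let f : Ω → ℝ≥0∞ := fun ω => ∏ i, (1 + (B i).indicator (fun _ => ENNReal.ofReal x) ω)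
  -- Here `f` is the exponential of `s` times the count. Expanding it over subsets, with nonnegative
  -- coefficients, leaves only the joint probabilities bounded by `h`; independence is not needed.
  have hprod : ∀ ω, f ω = ∑ T : Finset ι,
      (⋂ i ∈ T, B i).indicator (fun _ => ENNReal.ofReal x ^ T.card) ω := by
    intro ω
    simp only [f]
    rw [Finset.prod_one_add, Finset.powerset_univ]
    refine Finset.sum_congr rfl fun T _ => ?_
    by_cases hT : ∀ i ∈ T, ω ∈ B i
    · rw [Set.indicator_of_mem (by simpa using hT),
        Finset.prod_congr rfl fun i hi => Set.indicator_of_mem (hT i hi) _, Finset.prod_const]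
    · rw [Set.indicator_of_notMem (by simpa using hT)]
      push Not at hT
      obtain ⟨i, hi, hiB⟩ := hT
      exact Finset.prod_eq_zero hi (Set.indicator_of_notMem hiB _)
  have hmeasT : ∀ T : Finset ι, MeasurableSet (⋂ i ∈ T, B i) := fun T =>
    Finset.measurableSet_biInter T fun i _ => hB i
  have hint : ∫⁻ ω, f ω ∂μ ≤ ENNReal.ofReal ((1 + p * x) ^ N) := by
    simp_rw [hprod]
    rw [lintegral_finsetSum _ fun T _ => measurable_const.indicator (hmeasT T)]
    have e : (1 + p * x) ^ N = ∑ T : Finset ι, (x * p) ^ T.card := by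
      have := Finset.prod_one_add (f := fun _ : ι => p * x) Finset.univ
      simp only [Finset.prod_const, Finset.card_univ, Finset.powerset_univ] at this
      rw [hN, this]
      simp [mul_comm]
    rw [e, ENNReal.ofReal_sum_of_nonneg fun T _ => pow_nonneg (mul_nonneg hx0 hp0) T.card]
    refine Finset.sum_le_sum fun T _ => ?_
    rw [lintegral_indicator (hmeasT T), setLIntegral_const, mul_pow,
      ENNReal.ofReal_mul (by positivity), ENNReal.ofReal_pow hx0]
    gcongr
    exact h T
  have hfmeas : Measurable f := by
    refine Finset.measurable_fun_prod _ fun i _ => ?_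
    exact Measurable.const_add (measurable_const.indicator (hB i)) 1
  have hf : ∀ ω, f ω =
      ENNReal.ofReal (Real.exp (s * ((Finset.univ.filter fun i => ω ∈ B i).card : ℝ))) := by
    intro ω
    have : ∀ i, 1 + (B i).indicator (fun _ => ENNReal.ofReal x) ω
        = if ω ∈ B i then ENNReal.ofReal (Real.exp s) else 1 := by
      intro i
      by_cases hi : ω ∈ B i
      · rw [Set.indicator_of_mem hi, if_pos hi, ← ENNReal.ofReal_one,
          ← ENNReal.ofReal_add zero_le_one hx0]
        simp [hx]
      · simp [hi]
    simp only [f, this]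
    rw [Finset.prod_ite, Finset.prod_const, Finset.prod_const_one, mul_one,
      ← ENNReal.ofReal_pow (Real.exp_pos _).le, ← Real.exp_nat_mul, mul_comm]
  set c : ℝ := Real.exp (s * ((p + t) * N)) with hc
  have hcpos : 0 < c := Real.exp_pos _
  have hmarkov := mul_meas_ge_le_lintegral (μ := μ) hfmeas (ENNReal.ofReal c)
  have hsub : {ω | (p + t) * N ≤ ((Finset.univ.filter fun i => ω ∈ B i).card : ℝ)}
      ⊆ {ω | ENNReal.ofReal c ≤ f ω} := by
    intro ω hω
    simp only [Set.mem_ofPred_eq, hf] at hω ⊢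
    exact ENNReal.ofReal_le_ofReal (Real.exp_le_exp.2 (mul_le_mul_of_nonneg_left hω hs0))
  have hbound : (1 + p * x) ^ N ≤ c * Real.exp (-(2 * N * t ^ 2)) := by
    calc (1 + p * x) ^ N ≤ Real.exp (s * p + s ^ 2 / 8) ^ N := by
          gcongr
          exact one_add_mul_exp_sub_one_le hp0 hp1 s
      _ = c * Real.exp (-(2 * N * t ^ 2)) := by
          rw [← Real.exp_nat_mul, hc, ← Real.exp_add, hs]
          congr 1
          ring
  refine (measure_mono hsub).trans ?_
  have hc0 : ENNReal.ofReal c ≠ 0 := by simpa using hcpos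
  rw [← ENNReal.mul_le_mul_iff_right hc0 ENNReal.ofReal_ne_top]
  refine hmarkov.trans (hint.trans ?_)
  rw [← ENNReal.ofReal_mul hcpos.le]
  exact ENNReal.ofReal_le_ofReal hbound

/-! ### Sampling without replacement -/

/-- The ratio of the binomial coefficients is a product of factors `(K - j) / (N - j)`, each at most
`K / N`. -/
theorem Nat.choose_mul_pow_le {K N : ℕ} (h : K ≤ N) (k : ℕ) :
    K.choose k * N ^ k ≤ N.choose k * K ^ k := by
  have hd : ∀ k, K.descFactorial k * N ^ k ≤ N.descFactorial k * K ^ k := by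
    intro k
    induction k with
    | zero => simp
    | succ k ih =>
      rw [Nat.descFactorial_succ, Nat.descFactorial_succ, pow_succ, pow_succ]
      have h1 : (K - k) * N ≤ (N - k) * K := by
        rw [Nat.sub_mul, Nat.sub_mul, mul_comm N K]
        exact Nat.sub_le_sub_left (Nat.mul_le_mul_left k h) _
      calc (K - k) * K.descFactorial k * (N ^ k * N)
          = ((K - k) * N) * (K.descFactorial k * N ^ k) := by ring
        _ ≤ ((N - k) * K) * (N.descFactorial k * K ^ k) := Nat.mul_le_mul h1 ih
        _ = _ := by ring
  have h2 := hd k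
  rw [Nat.descFactorial_eq_factorial_mul_choose, Nat.descFactorial_eq_factorial_mul_choose,
    mul_assoc, mul_assoc] at h2
  exact Nat.le_of_mul_le_mul_left h2 k.factorial_pos

/-- Sampling without replacement is dominated by sampling with replacement: if an exchangeable
random subset always contains at most a fraction `p` of the indices, then it contains `k` given
indices with probability at most `p ^ k`. -/
theorem measure_biInter_le_pow_of_exchangeable {Ω ι : Type*} [MeasurableSpace Ω] {μ : Measure Ω}
    [IsProbabilityMeasure μ] [Fintype ι] (B : ι → Set Ω) [∀ ω, DecidablePred fun i => ω ∈ B i]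
    (hB : ∀ i, MeasurableSet (B i)) {p : ℝ}
    (hexch : ∀ T T' : Finset ι, T.card = T'.card → μ (⋂ i ∈ T, B i) = μ (⋂ i ∈ T', B i))
    (hcard : ∀ ω, ((Finset.univ.filter fun i => ω ∈ B i).card : ℝ) ≤ p * Fintype.card ι)
    (T : Finset ι) : μ (⋂ i ∈ T, B i) ≤ ENNReal.ofReal (p ^ T.card) := by
  classical
  set N := Fintype.card ι with hN
  set k := T.card with hk
  have hkN : k ≤ N := Finset.card_le_univ T
  have hmeasT : ∀ T : Finset ι, MeasurableSet (⋂ i ∈ T, B i) := fun T =>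
    Finset.measurableSet_biInter T fun i _ => hB i
  -- Both sides count the `k`-subsets of the random index set. Taking expectations, exchangeability
  -- makes all terms on the left equal.
  have hchoose : ∀ ω, ∑ T' ∈ Finset.powersetCard k (Finset.univ : Finset ι),
      (⋂ i ∈ T', B i).indicator (fun _ => (1 : ℝ≥0∞)) ω
        = ((Finset.univ.filter fun i => ω ∈ B i).card.choose k : ℕ) := by
    intro ω
    rw [← Finset.card_powersetCard, Finset.card_eq_sum_ones, Nat.cast_sum, Nat.cast_one]
    have : Finset.powersetCard k (Finset.univ.filter fun i => ω ∈ B i)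
        = (Finset.powersetCard k (Finset.univ : Finset ι)).filter
          fun T' => ω ∈ ⋂ i ∈ T', B i := by
      ext T'
      simp only [Finset.mem_powersetCard, Finset.mem_filter, Set.mem_iInter, true_and, Finset.subset_iff, Finset.mem_univ]
      tauto
    rw [this, Finset.sum_filter]
    refine Finset.sum_congr rfl fun T' _ => ?_
    by_cases hT : ω ∈ ⋂ i ∈ T', B i
    · rw [Set.indicator_of_mem hT, if_pos hT]
    · rw [Set.indicator_of_notMem hT, if_neg hT]
  have hreal : ∀ ω, ((Finset.univ.filter fun i => ω ∈ B i).card.choose k : ℝ)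
      ≤ N.choose k * p ^ k := by
    intro ω
    set K := (Finset.univ.filter fun i => ω ∈ B i).card with hK
    rcases Nat.eq_zero_or_pos k with h0 | hkpos
    · simp [h0]
    have hNpos : (0 : ℝ) < N := by exact_mod_cast hkpos.trans_le hkN
    have h1 : (K.choose k : ℝ) * N ^ k ≤ N.choose k * K ^ k := by
      exact_mod_cast Nat.choose_mul_pow_le (Finset.card_le_univ _) k
    have h2 : (K : ℝ) ^ k ≤ (p * N) ^ k := by
      gcongr
      exact hcard ω
    have h3 : (K.choose k : ℝ) * N ^ k ≤ (N.choose k * p ^ k) * N ^ k := by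
      refine h1.trans ?_
      rw [mul_assoc, ← mul_pow]
      gcongr
    exact le_of_mul_le_mul_right h3 (by positivity)
  have hsum : (N.choose k : ℝ≥0∞) * μ (⋂ i ∈ T, B i)
      = ∫⁻ ω, ((Finset.univ.filter fun i => ω ∈ B i).card.choose k : ℕ) ∂μ := by
    simp_rw [← hchoose]
    rw [lintegral_finsetSum _ fun T' _ => measurable_const.indicator (hmeasT T')]
    rw [Finset.sum_congr rfl (g := fun _ => μ (⋂ i ∈ T, B i))]
    · simp [hN]
    · intro T' hT'
      rw [lintegral_indicator (hmeasT T'), setLIntegral_const, one_mul]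
      exact hexch _ _ (Finset.mem_powersetCard.1 hT').2
  have hle : (N.choose k : ℝ≥0∞) * μ (⋂ i ∈ T, B i)
      ≤ N.choose k * ENNReal.ofReal (p ^ k) := by
    rw [hsum]
    calc ∫⁻ ω, ((Finset.univ.filter fun i => ω ∈ B i).card.choose k : ℕ) ∂μ
        ≤ ∫⁻ _, N.choose k * ENNReal.ofReal (p ^ k) ∂μ := by
          refine lintegral_mono fun ω => ?_
          rw [← ENNReal.ofReal_natCast, ← ENNReal.ofReal_natCast (N.choose k),
            ← ENNReal.ofReal_mul (by positivity)]
          exact ENNReal.ofReal_le_ofReal (hreal ω)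
      _ = _ := by simp
  rwa [ENNReal.mul_le_mul_iff_right (by exact_mod_cast (Nat.choose_pos hkN).ne')
    (ENNReal.natCast_ne_top _)] at hle

/-! ### Exchangeability and Hoeffding bounds for i.i.d. data -/

theorem measurePreserving_comp_equiv {ι κ Z : Type*} [Fintype ι] [Fintype κ] [MeasurableSpace Z]
    (P : Measure Z) [SigmaFinite P] (e : ι ≃ κ) :
    MeasurePreserving (fun (D : κ → Z) (i : ι) => D (e i)) (Measure.pi fun _ => P)
      (Measure.pi fun _ => P) := by
  have h := measurePreserving_piCongrLeft (α := fun _ : ι => Z) (fun _ => P) e.symm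
  convert h using 1
  ext D i
  exact ((Equiv.piCongrLeft_apply (P := fun _ : ι => Z) e.symm D i).trans (by simp)).symm

theorem measurePreserving_split {ι κ τ Z : Type*} [Fintype ι] [Fintype κ] [Fintype τ]
    [MeasurableSpace Z] (P : Measure Z) [SigmaFinite P] (e : ι ⊕ κ ≃ τ) :
    MeasurePreserving (fun D : τ → Z => (fun i => D (e (.inl i)), fun j => D (e (.inr j))))
      (Measure.pi fun _ => P) ((Measure.pi fun _ : ι => P).prod (Measure.pi fun _ : κ => P)) :=
  (measurePreserving_sumPiEquivProdPi (X := fun _ : ι ⊕ κ => Z) fun _ => P).comp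
    (measurePreserving_comp_equiv P e)

theorem exists_perm_map_eq {ι : Type*} [Fintype ι] {T T' : Finset ι}
    (h : T.card = T'.card) : ∃ σ : Equiv.Perm ι, ∀ i, σ i ∈ T' ↔ i ∈ T := by
  classical
  let e : {i // i ∈ T} ≃ {i // i ∈ T'} := Finset.equivOfCardEq h
  refine ⟨e.extendSubtype, fun i => ?_⟩
  by_cases hi : i ∈ T
  · exact iff_of_true (e.extendSubtype_mem i hi) hi
  · exact iff_of_false (e.extendSubtype_not_mem i hi) hi

/-- Permutation-equivariant random index sets built from i.i.d. data are exchangeable. -/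
theorem measure_biInter_eq_of_equivariant {ι Z : Type*} [Fintype ι] [MeasurableSpace Z]
    (P : Measure Z) [SigmaFinite P] (B : ι → Set (ι → Z)) (hB : ∀ i, MeasurableSet (B i))
    (hequiv : ∀ (σ : Equiv.Perm ι) (D : ι → Z) (i : ι), (fun k => D (σ k)) ∈ B i ↔ D ∈ B (σ i))
    {T T' : Finset ι} (h : T.card = T'.card) :
    Measure.pi (fun _ => P) (⋂ i ∈ T, B i) = Measure.pi (fun _ => P) (⋂ i ∈ T', B i) := by
  obtain ⟨σ, hσ⟩ := exists_perm_map_eq h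
  rw [← (measurePreserving_comp_equiv P σ).measure_preimage
    (Finset.measurableSet_biInter T fun i _ => hB i).nullMeasurableSet]
  congr 1
  ext D
  simp only [Set.mem_preimage, Set.mem_iInter, hequiv]
  constructor
  · intro hD i hi
    have := hD (σ.symm i) ((hσ _).1 (by simpa using hi))
    simpa using this
  · exact fun hD i hi => hD _ ((hσ i).2 hi)

/-- Hoeffding's inequality for sampling without replacement: an equivariant index set that holds
at most a fraction `p` of all indices holds much more than a fraction `p` of the sample
`f : κ ↪ ι` only with small probability. -/
theorem measure_card_filter_embedding_ge_le {ι κ Z : Type*} [Fintype ι] [Fintype κ]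
    [MeasurableSpace Z] (P : Measure Z) [IsProbabilityMeasure P] (B : ι → Set (ι → Z))
    [∀ D, DecidablePred fun i => D ∈ B i] (f : κ ↪ ι)
    (hB : ∀ i, MeasurableSet (B i))
    (hequiv : ∀ (σ : Equiv.Perm ι) (D : ι → Z) (i : ι), (fun k => D (σ k)) ∈ B i ↔ D ∈ B (σ i))
    {p t : ℝ} (hp0 : 0 ≤ p) (hp1 : p ≤ 1) (ht : 0 ≤ t)
    (hcard : ∀ D, ((Finset.univ.filter fun i => D ∈ B i).card : ℝ) ≤ p * Fintype.card ι) :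
    Measure.pi (fun _ => P) {D | (p + t) * Fintype.card κ
        ≤ ((Finset.univ.filter fun j => D ∈ B (f j)).card : ℝ)}
      ≤ ENNReal.ofReal (Real.exp (-(2 * Fintype.card κ * t ^ 2))) := by
  refine measure_card_filter_ge_le (fun j => B (f j)) (fun j => hB _) hp0 hp1 ht fun T => ?_
  have h := measure_biInter_le_pow_of_exchangeable (μ := Measure.pi fun _ : ι => P) B hB
    (fun T T' => measure_biInter_eq_of_equivariant P B hB hequiv) hcard (T.map f)
  rw [Finset.card_map] at h
  refine le_trans (measure_mono ?_) h
  intro D hD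
  simpa using hD

/-- Hoeffding's inequality for the test points, given the training data. -/
theorem measure_prod_card_filter_ge_le {Y κ Z : Type*} [Fintype κ] [MeasurableSpace Y]
    [MeasurableSpace Z] (Q : Measure Y) [IsProbabilityMeasure Q] (P : Measure Z)
    [IsProbabilityMeasure P] (M : Set (Y × Z)) [DecidablePred fun q => q ∈ M]
    (hM : MeasurableSet M) {t : ℝ} (ht : 0 ≤ t) :
    (Q.prod (Measure.pi fun _ : κ => P)) {q | (P.real {z | (q.1, z) ∉ M} + t) * Fintype.card κ
        ≤ ((Finset.univ.filter fun j => (q.1, q.2 j) ∉ M).card : ℝ)}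
      ≤ ENNReal.ofReal (Real.exp (-(2 * Fintype.card κ * t ^ 2))) := by
  have hmeas : MeasurableSet {q : Y × (κ → Z) |
      (P.real {z | (q.1, z) ∉ M} + t) * Fintype.card κ
        ≤ ((Finset.univ.filter fun j => (q.1, q.2 j) ∉ M).card : ℝ)} := by
    refine measurableSet_le ?_ ?_
    · have h1 : Measurable fun y => P.real {z | (y, z) ∉ M} :=
        (measurable_measure_prodMk_left hM.compl).ennreal_toReal
      exact ((h1.comp measurable_fst).add_const t).mul_const _
    · simp only [Finset.card_filter, Nat.cast_sum]
      refine Finset.measurable_fun_sum _ fun j _ => ?_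
      simp only [Nat.cast_ite, Nat.cast_one, Nat.cast_zero]
      refine Measurable.ite ?_ measurable_const measurable_const
      have h : Measurable fun q : Y × (κ → Z) => (q.1, q.2 j) := by fun_prop
      exact h hM.compl
  rw [Measure.prod_apply hmeas]
  -- By Fubini the training data `y` may be fixed; the test events are then independent and their
  -- joint probabilities are exact powers.
  refine (lintegral_mono (g := fun _ =>
    ENNReal.ofReal (Real.exp (-(2 * Fintype.card κ * t ^ 2)))) fun y => ?_).trans (by simp)
  have hMy : MeasurableSet {z | (y, z) ∉ M} := measurable_prodMk_left hM.compl
  refine measure_card_filter_ge_le (fun j : κ => {D : κ → Z | (y, D j) ∉ M})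
    (fun j => (measurable_pi_apply j : Measurable fun D : κ → Z => D j) hMy)
    (p := P.real {z | (y, z) ∉ M}) measureReal_nonneg measureReal_le_one ht fun T => ?_
  classical
  have e : (⋂ i ∈ T, {D : κ → Z | (y, D i) ∉ M})
      = Set.univ.pi fun i => if i ∈ T then {z | (y, z) ∉ M} else Set.univ := by
    ext D
    simp only [Set.mem_iInter, Set.mem_pi, Set.mem_univ, true_implies]
    refine forall_congr' fun i => ?_
    by_cases hi : i ∈ T <;> simp [hi]
  rw [e, Measure.pi_pi, ENNReal.ofReal_pow measureReal_nonneg, ofReal_measureReal]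
  refine le_of_eq ?_
  simp only [apply_ite P, measure_univ]
  rw [Finset.prod_ite]
  simp

/-! ### Deterministic bounds on ranks -/

/-- All selected indices lie at or below the selected one with the largest value, which has fewer
than `b` indices there. Ties do no harm. -/
theorem card_filter_card_le_lt_le {ι : Type*} [Fintype ι] (R : ι → ℝ) {b : ℝ} (hb : 0 ≤ b) :
    ((Finset.univ.filter fun i =>
      ((Finset.univ.filter fun k => R k ≤ R i).card : ℝ) < b).card : ℝ) ≤ b := by
  set S := Finset.univ.filter fun i =>
    ((Finset.univ.filter fun k => R k ≤ R i).card : ℝ) < b with hS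
  rcases S.eq_empty_or_nonempty with h | h
  · simpa [h] using hb
  · obtain ⟨i, hi, hmax⟩ := S.exists_max_image R h
    have h1 : S ⊆ Finset.univ.filter fun k => R k ≤ R i := fun k hk => by
      simpa using hmax k hk
    have h2 : (S.card : ℝ) ≤ (Finset.univ.filter fun k => R k ≤ R i).card := by
      exact_mod_cast Finset.card_le_card h1
    exact h2.trans (Finset.mem_filter.1 hi).2.le

/-- At least `b` indices lie strictly below the selected one with the smallest value, and none of
them is selected. -/
theorem card_filter_le_card_lt_le {ι : Type*} [Fintype ι] (R : ι → ℝ) {b : ℝ}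
    (hb : b ≤ Fintype.card ι) :
    ((Finset.univ.filter fun i =>
      b ≤ ((Finset.univ.filter fun k => R k < R i).card : ℝ)).card : ℝ)
      ≤ Fintype.card ι - b := by
  classical
  set S := Finset.univ.filter fun i =>
    b ≤ ((Finset.univ.filter fun k => R k < R i).card : ℝ) with hS
  rcases S.eq_empty_or_nonempty with h | h
  · simpa [h] using hb
  · obtain ⟨i, hi, hmin⟩ := S.exists_min_image R h
    have h1 : Disjoint S (Finset.univ.filter fun k => R k < R i) := by
      rw [Finset.disjoint_left]
      intro k hk hk'
      exact absurd (hmin k hk) (not_le.2 (Finset.mem_filter.1 hk').2)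
    have h2 : (S.card : ℝ) + (Finset.univ.filter fun k => R k < R i).card
        ≤ Fintype.card ι := by
      exact_mod_cast (Finset.card_union_of_disjoint h1).symm.trans_le (Finset.card_le_univ _)
    have h3 := (Finset.mem_filter.1 hi).2
    linarith

/-! ### Markov bounds for the number of bad events -/

section Counting

variable {Ω κ : Type*} [MeasurableSpace Ω] {μ : Measure Ω} [Fintype κ]

theorem measurable_card_filter_mem (F : κ → Set Ω) [∀ ω, DecidablePred fun j => ω ∈ F j]
    (hF : ∀ j, MeasurableSet (F j)) :
    Measurable fun ω => ((Finset.univ.filter fun j => ω ∈ F j).card : ℝ) := by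
  simp only [Finset.card_filter, Nat.cast_sum]
  refine Finset.measurable_fun_sum _ fun j _ => ?_
  simp only [Nat.cast_ite, Nat.cast_one, Nat.cast_zero]
  exact Measurable.ite (hF j) measurable_const measurable_const

/-- Markov's inequality for the number of events that occur, on the set where it is large. -/
theorem mul_measure_lt_card_filter_le (F : κ → Set Ω) [∀ ω, DecidablePred fun j => ω ∈ F j]
    (hF : ∀ j, MeasurableSet (F j)) (c : ℝ) :
    ENNReal.ofReal c * μ {ω | c < ((Finset.univ.filter fun j => ω ∈ F j).card : ℝ)}
      ≤ ∑ j, μ (F j ∩ {ω | c < ((Finset.univ.filter fun j => ω ∈ F j).card : ℝ)}) := by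
  set L := {ω | c < ((Finset.univ.filter fun j => ω ∈ F j).card : ℝ)} with hL
  have hLm : MeasurableSet L :=
    measurableSet_lt measurable_const (measurable_card_filter_mem F hF)
  calc ENNReal.ofReal c * μ L = ∫⁻ _ in L, ENNReal.ofReal c ∂μ := by rw [setLIntegral_const]
    _ ≤ ∫⁻ ω in L, ∑ j, (F j).indicator (fun _ => (1 : ℝ≥0∞)) ω ∂μ := by
        refine setLIntegral_mono' hLm fun ω hω => ?_
        have : ∑ j, (F j).indicator (fun _ => (1 : ℝ≥0∞)) ω
            = ((Finset.univ.filter fun j => ω ∈ F j).card : ℕ) := by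
          rw [Finset.card_filter, Nat.cast_sum]
          refine Finset.sum_congr rfl fun j _ => ?_
          by_cases hj : ω ∈ F j <;> simp [hj]
        rw [this, ← ENNReal.ofReal_natCast]
        exact ENNReal.ofReal_le_ofReal (le_of_lt hω)
    _ = ∑ j, μ (F j ∩ L) := by
        rw [lintegral_finsetSum _ fun j _ => measurable_const.indicator (hF j)]
        refine Finset.sum_congr rfl fun j _ => ?_
        rw [lintegral_indicator (hF j), setLIntegral_const, one_mul,
          Measure.restrict_apply (hF j)]

theorem measurableSet_union_lt_card_filter (G : κ → Set Ω)
    [∀ ω, DecidablePred fun j => ω ∈ G j] (hG : ∀ j, MeasurableSet (G j)) (c : ℝ) (k : κ) :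
    MeasurableSet (G k ∪ {ω | c < ((Finset.univ.filter fun j => ω ∈ G j).card : ℝ)}) :=
  (hG k).union (measurableSet_lt measurable_const (measurable_card_filter_mem G hG))

/-- For exchangeable events, the probability that a given one occurs or more than a fraction `ρ`
of them occur, exceeds the probability of the given one by a factor of at most `1 / ρ`. -/
theorem mul_measure_union_lt_card_filter_le (G : κ → Set Ω)
    [∀ ω, DecidablePred fun j => ω ∈ G j] (hG : ∀ j, MeasurableSet (G j))
    (hexch : ∀ k k', ∃ φ : Ω → Ω, MeasurePreserving φ μ μ ∧ ∃ σ : Equiv.Perm κ, σ k = k' ∧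
      ∀ ω i, φ ω ∈ G i ↔ ω ∈ G (σ i))
    {ρ : ℝ} (hρ0 : 0 ≤ ρ) (hρ1 : ρ ≤ 1) (k : κ) :
    ENNReal.ofReal ρ * μ (G k ∪
        {ω | ρ * Fintype.card κ < ((Finset.univ.filter fun j => ω ∈ G j).card : ℝ)})
      ≤ μ (G k) := by
  set L := {ω | ρ * Fintype.card κ < ((Finset.univ.filter fun j => ω ∈ G j).card : ℝ)} with hL
  have hLm : MeasurableSet L :=
    measurableSet_lt measurable_const (measurable_card_filter_mem G hG)
  -- The map `φ` carries `G k` to `G k'` and preserves `L`, which depends on the count alone.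
  have hboth : ∀ k', μ (G k) = μ (G k') ∧ μ (G k \ L) = μ (G k' \ L) := by
    intro k'
    obtain ⟨φ, hφ, σ, hσ, hGσ⟩ := hexch k k'
    have h1 : φ ⁻¹' G k = G k' := by
      ext ω
      rw [Set.mem_preimage, hGσ, hσ]
    have h2 : φ ⁻¹' L = L := by
      ext ω
      have hc : (Finset.univ.filter fun j => φ ω ∈ G j).card
          = (Finset.univ.filter fun j => ω ∈ G j).card :=
        Finset.card_bij (fun i _ => σ i) (by simp [hGσ]) (by simp)
          fun i hi => ⟨σ.symm i, by simpa [hGσ] using hi, by simp⟩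
      simp only [hL, Set.mem_preimage, Set.mem_ofPred_eq, hc]
    refine ⟨?_, ?_⟩
    · rw [← h1, hφ.measure_preimage (hG k).nullMeasurableSet]
    · rw [← hφ.measure_preimage ((hG k).diff hLm).nullMeasurableSet, Set.preimage_sdiff, h1, h2]
  have hcard0 : (Fintype.card κ : ℝ≥0∞) ≠ 0 := by
    have : Nonempty κ := ⟨k⟩
    simp
  rw [← ENNReal.mul_le_mul_iff_right hcard0 (ENNReal.natCast_ne_top _)]
  -- Splitting off `L` avoids counting the overlap twice: Markov's inequality for `L` uses up only
  -- the parts `G j ∩ L`, and the parts `G j \ L` remain for the other term.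
  have hU : G k ∪ L = (G k \ L) ∪ L := Set.sdiff_union_self.symm
  calc (Fintype.card κ : ℝ≥0∞) * (ENNReal.ofReal ρ * μ (G k ∪ L))
      ≤ Fintype.card κ * (μ (G k \ L) + ENNReal.ofReal ρ * μ L) := by
        gcongr
        rw [hU]
        refine (mul_le_mul_right (measure_union_le _ _) _).trans ?_
        rw [mul_add]
        gcongr
        exact mul_le_of_le_one_left (zero_le) (by simpa using hρ1)
    _ = ∑ j, μ (G j \ L) + ENNReal.ofReal (ρ * Fintype.card κ) * μ L := by
        rw [mul_add, Finset.sum_congr rfl fun j _ => (hboth j).2.symm, Finset.sum_const,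
          Finset.card_univ, nsmul_eq_mul, ENNReal.ofReal_mul hρ0, ENNReal.ofReal_natCast]
        ring
    _ ≤ ∑ j, μ (G j \ L) + ∑ j, μ (G j ∩ L) := by
        gcongr
        exact mul_measure_lt_card_filter_le G hG _
    _ = ∑ j, μ (G j) := by
        rw [← Finset.sum_add_distrib]
        exact Finset.sum_congr rfl fun j _ => by rw [add_comm, measure_inter_add_sdiff _ hLm]
    _ = Fintype.card κ * μ (G k) := by
        rw [Finset.sum_congr rfl fun j _ => (hboth j).1.symm, Finset.sum_const,
          Finset.card_univ, nsmul_eq_mul]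

/-- The second Markov step, dividing by `ρ`. For `ρ = 0` exchangeability makes every event null,
hence their union too. -/
theorem measure_union_lt_card_filter_le_ofReal (G : κ → Set Ω)
    [∀ ω, DecidablePred fun j => ω ∈ G j] (hG : ∀ j, MeasurableSet (G j))
    (hexch : ∀ k k', ∃ φ : Ω → Ω, MeasurePreserving φ μ μ ∧ ∃ σ : Equiv.Perm κ, σ k = k' ∧
      ∀ ω i, φ ω ∈ G i ↔ ω ∈ G (σ i))
    {ρ : ℝ} (hρ0 : 0 ≤ ρ) (hρ1 : ρ ≤ 1) (k : κ) (h : μ (G k) ≤ ENNReal.ofReal (ρ ^ 3)) :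
    μ (G k ∪ {ω | ρ * Fintype.card κ < ((Finset.univ.filter fun j => ω ∈ G j).card : ℝ)})
      ≤ ENNReal.ofReal (ρ ^ 2) := by
  rcases hρ0.eq_or_lt with h0 | hpos
  · have hnull : ∀ j, μ (G j) = 0 := fun j => by
      obtain ⟨φ, hφ, σ, hσ, hGσ⟩ := hexch k j
      have h1 : φ ⁻¹' G k = G j := by
        ext ω
        rw [Set.mem_preimage, hGσ, hσ]
      rw [← h1, hφ.measure_preimage (hG k).nullMeasurableSet]
      simpa [← h0] using h
    refine (measure_mono_null (t := ⋃ j, G j) ?_ (measure_iUnion_null hnull)).trans_le zero_le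
    rintro ω (hω | hω)
    · exact Set.mem_iUnion.2 ⟨k, hω⟩
    · have : 0 < (Finset.univ.filter fun j => ω ∈ G j).card := by
        simpa [← h0, Finset.card_pos] using hω
      obtain ⟨j, hj⟩ := Finset.card_pos.1 this
      exact Set.mem_iUnion.2 ⟨j, by simpa using hj⟩
  · have hM := mul_measure_union_lt_card_filter_le G hG hexch hρ0 hρ1 k
    rw [← ENNReal.mul_le_mul_iff_right (a := ENNReal.ofReal ρ) (by simpa using hpos)
      ENNReal.ofReal_ne_top, ← ENNReal.ofReal_mul hρ0, ← pow_succ']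
    exact hM.trans h

/-- The third Markov step; again `ρ = 0` is a union of null events. -/
theorem measure_lt_card_filter_le_ofReal [Nonempty κ] (F : κ → Set Ω)
    [∀ ω, DecidablePred fun j => ω ∈ F j] (hF : ∀ j, MeasurableSet (F j))
    {ρ : ℝ} (hρ0 : 0 ≤ ρ) (h : ∀ j, μ (F j) ≤ ENNReal.ofReal (ρ ^ 2)) :
    μ {ω | ρ * Fintype.card κ < ((Finset.univ.filter fun j => ω ∈ F j).card : ℝ)}
      ≤ ENNReal.ofReal ρ := by
  rcases hρ0.eq_or_lt with h0 | hpos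
  · have hnull : ∀ j, μ (F j) = 0 := fun j => by simpa [← h0] using h j
    refine (measure_mono_null (t := ⋃ j, F j) ?_ (measure_iUnion_null hnull)).trans_le
      (zero_le)
    intro ω hω
    have : 0 < (Finset.univ.filter fun j => ω ∈ F j).card := by
      simpa [← h0, Finset.card_pos] using hω
    obtain ⟨j, hj⟩ := Finset.card_pos.1 this
    exact Set.mem_iUnion.2 ⟨j, by simpa using hj⟩
  · have hM := mul_measure_lt_card_filter_le (μ := μ) F hF (ρ * Fintype.card κ)
    have hc : 0 < ρ * Fintype.card κ := by
      have : 0 < Fintype.card κ := Fintype.card_pos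
      positivity
    rw [← ENNReal.mul_le_mul_iff_right (a := ENNReal.ofReal (ρ * Fintype.card κ))
      (by simpa using hc) ENNReal.ofReal_ne_top]
    refine hM.trans ((Finset.sum_le_sum fun j _ =>
      (measure_mono Set.inter_subset_left).trans (h j)).trans_eq ?_)
    rw [Finset.sum_const, Finset.card_univ, nsmul_eq_mul, ← ENNReal.ofReal_natCast,
      ← ENNReal.ofReal_mul (by positivity), ← ENNReal.ofReal_mul hc.le]
    congr 1
    ring

end Counting

/-! ### Quantiles as counts, and the indexing of the data -/

/-- The strict inequality leaves room for a real `t` in the set defining the infimum with `t + γ <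
r`, so it does not matter whether the infimum is attained or equals `-∞`. -/
theorem le_card_filter_lt_of_quantile_add_lt {n : ℕ} (v : Fin n → ℝ) {τ γ r : ℝ}
    (h : quantile v τ + (γ : EReal) < (r : EReal)) :
    τ * n ≤ ((Finset.univ.filter fun i => v i + γ < r).card : ℝ) := by
  have h1 : quantile v τ < ((r - γ : ℝ) : EReal) := by
    rw [EReal.coe_sub]
    exact EReal.lt_sub_iff_add_lt (by simp) (by simp) |>.2 h
  obtain ⟨_, ⟨t, ht, rfl⟩, htr⟩ := sInf_lt_iff.1 h1
  have htr : t < r - γ := EReal.coe_lt_coe_iff.1 htr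
  refine le_trans (show τ * n ≤ _ from ht) ?_
  norm_cast
  refine Finset.card_le_card fun i hi => ?_
  simp only [Finset.mem_filter, Finset.mem_univ, true_and] at hi ⊢
  linarith

/-- The bijection of training points and test points with all points; the first test point comes
right after the training points. -/
def trainTestEquiv (n m : ℕ) : Fin n ⊕ Fin (m + 1) ≃ Fin (n + 1 + m) :=
  finSumFinEquiv.trans (finCongr (by omega))

theorem trainTestEquiv_inl (n m : ℕ) (k : Fin n) :
    trainTestEquiv n m (.inl k) = Fin.castAdd m k.castSucc := by
  ext
  simp [trainTestEquiv]

theorem trainTestEquiv_inr_zero (n m : ℕ) :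
    trainTestEquiv n m (.inr 0) = Fin.castAdd m (Fin.last n) := by
  ext
  simp [trainTestEquiv]

/-! ### Miscoverage and residual ranks -/

namespace RegressionAlgorithm

variable {𝓧 : Type*} [MeasurableSpace 𝓧]

/-- Pairs of training data `D` and a test point `(x, y)` for which the residual of the test point
exceeds by more than `γ` those of at least `(1 - α) (n + 1)` training points. -/
def miscoveredSet (A : RegressionAlgorithm 𝓧) (α γ : ℝ) (n : ℕ) :
    Set ((Fin n → 𝓧 × ℝ) × (𝓧 × ℝ)) :=
  {q | (1 - α) * (n + 1) ≤ ((Finset.univ.filter fun i =>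
    |(q.1 i).2 - augmentedModel A q.1 q.2.1 q.2.2 (q.1 i).1| + γ
      < |q.2.2 - augmentedModel A q.1 q.2.1 q.2.2 q.2.1|).card : ℝ)}

theorem mem_miscoveredSet_of_notMem_conformalSet (A : RegressionAlgorithm 𝓧) {α γ : ℝ} {n : ℕ}
    (hn : 1 ≤ n) {D : Fin n → 𝓧 × ℝ} {z : 𝓧 × ℝ} (h : z.2 ∉ conformalSet A α γ D z.1) :
    (D, z) ∈ A.miscoveredSet α γ n := by
  have h1 := le_card_filter_lt_of_quantile_add_lt _ (not_le.1 h)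
  have hn' : (n : ℝ) ≠ 0 := by positivity
  have e : (1 - α) * (1 + 1 / (n : ℝ)) * n = (1 - α) * (n + 1) := by field_simp
  rw [e] at h1
  exact h1

theorem measurable_fit_comp (A : RegressionAlgorithm 𝓧) {Y : Type*} [MeasurableSpace Y] {k : ℕ}
    {f : Y → Fin k → 𝓧 × ℝ} {g : Y → 𝓧} (hf : Measurable f) (hg : Measurable g) :
    Measurable fun y => A.fit k (f y) (g y) :=
  (A.measurable_fit k).comp (hf.prodMk hg)

theorem measurableSet_miscoveredSet (A : RegressionAlgorithm 𝓧) (α γ : ℝ) (n : ℕ) :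
    MeasurableSet (A.miscoveredSet α γ n) := by
  have hsnoc : Measurable fun q : (Fin n → 𝓧 × ℝ) × (𝓧 × ℝ) =>
      (Fin.snoc (α := fun _ => 𝓧 × ℝ) q.1 (q.2.1, q.2.2) : Fin (n + 1) → 𝓧 × ℝ) := by
    refine measurable_pi_iff.2 fun i => ?_
    refine Fin.lastCases ?_ (fun i => ?_) i
    · simpa using measurable_snd
    · simp only [Fin.snoc_castSucc]
      fun_prop
  classical
  refine measurableSet_le measurable_const
    (measurable_card_filter_mem (fun i => {q : (Fin n → 𝓧 × ℝ) × (𝓧 × ℝ) |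
      |(q.1 i).2 - augmentedModel A q.1 q.2.1 q.2.2 (q.1 i).1| + γ
        < |q.2.2 - augmentedModel A q.1 q.2.1 q.2.2 q.2.1|}) fun i => ?_)
  have h1 : Measurable fun q : (Fin n → 𝓧 × ℝ) × (𝓧 × ℝ) =>
      augmentedModel A q.1 q.2.1 q.2.2 (q.1 i).1 :=
    A.measurable_fit_comp hsnoc (by fun_prop)
  have h2 : Measurable fun q : (Fin n → 𝓧 × ℝ) × (𝓧 × ℝ) =>
      augmentedModel A q.1 q.2.1 q.2.2 q.2.1 :=
    A.measurable_fit_comp hsnoc (by fun_prop)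
  have h3 : Measurable fun q : (Fin n → 𝓧 × ℝ) × (𝓧 × ℝ) => (q.1 i).2 := by fun_prop
  have h4 : Measurable fun q : (Fin n → 𝓧 × ℝ) × (𝓧 × ℝ) => q.2.2 := by fun_prop
  exact measurableSet_lt ((h3.sub h1).abs.add_const γ) (h4.sub h2).abs

/-- The residual of the `i`-th point for the model fitted to the whole data set. -/
def residual (A : RegressionAlgorithm 𝓧) {N : ℕ} (D : Fin N → 𝓧 × ℝ) (i : Fin N) : ℝ :=
  |(D i).2 - A.fit N D (D i).1|

theorem measurable_residual (A : RegressionAlgorithm 𝓧) {N : ℕ} (i : Fin N) :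
    Measurable fun D : Fin N → 𝓧 × ℝ => A.residual D i := by
  have h1 : Measurable fun D : Fin N → 𝓧 × ℝ => A.fit N D (D i).1 :=
    A.measurable_fit_comp measurable_id (by fun_prop)
  have h2 : Measurable fun D : Fin N → 𝓧 × ℝ => (D i).2 := by fun_prop
  exact (h2.sub h1).abs

theorem residual_perm {A : RegressionAlgorithm 𝓧} (hA : A.IsSymmetric) {N : ℕ}
    (σ : Equiv.Perm (Fin N)) (D : Fin N → 𝓧 × ℝ) (i : Fin N) :
    A.residual (fun k => D (σ k)) i = A.residual D (σ i) := by
  rw [residual, residual, hA]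

/-- The data sets whose `i`-th residual is among the smallest, with fewer than `b` residuals
up to it. -/
def lowResidualSet (A : RegressionAlgorithm 𝓧) {N : ℕ} (b : ℝ) (i : Fin N) :
    Set (Fin N → 𝓧 × ℝ) :=
  {D | ((Finset.univ.filter fun k => A.residual D k ≤ A.residual D i).card : ℝ) < b}

/-- The data sets whose `i`-th residual exceeds at least `b` other residuals. -/
def highResidualSet (A : RegressionAlgorithm 𝓧) {N : ℕ} (b : ℝ) (i : Fin N) :
    Set (Fin N → 𝓧 × ℝ) :=
  {D | b ≤ ((Finset.univ.filter fun k => A.residual D k < A.residual D i).card : ℝ)}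

theorem measurableSet_lowResidualSet (A : RegressionAlgorithm 𝓧) {N : ℕ} (b : ℝ) (i : Fin N) :
    MeasurableSet (A.lowResidualSet b i) := by
  classical
  exact measurableSet_lt (measurable_card_filter_mem
    (fun k => {D | A.residual D k ≤ A.residual D i}) fun k =>
      measurableSet_le (A.measurable_residual k) (A.measurable_residual i)) measurable_const

theorem measurableSet_highResidualSet (A : RegressionAlgorithm 𝓧) {N : ℕ} (b : ℝ) (i : Fin N) :
    MeasurableSet (A.highResidualSet b i) := by
  classical
  exact measurableSet_le measurable_const (measurable_card_filter_mem
    (fun k => {D | A.residual D k < A.residual D i}) fun k =>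
      measurableSet_lt (A.measurable_residual k) (A.measurable_residual i))

theorem perm_mem_lowResidualSet {A : RegressionAlgorithm 𝓧} (hA : A.IsSymmetric) {N : ℕ} (b : ℝ)
    (σ : Equiv.Perm (Fin N)) (D : Fin N → 𝓧 × ℝ) (i : Fin N) :
    (fun k => D (σ k)) ∈ A.lowResidualSet b i ↔ D ∈ A.lowResidualSet b (σ i) := by
  simp only [lowResidualSet, Set.mem_ofPred_eq, residual_perm hA]
  rw [Finset.card_equiv σ (t := Finset.univ.filter fun k => A.residual D k ≤ A.residual D (σ i))
    (by simp)]

theorem perm_mem_highResidualSet {A : RegressionAlgorithm 𝓧} (hA : A.IsSymmetric) {N : ℕ} (b : ℝ)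
    (σ : Equiv.Perm (Fin N)) (D : Fin N → 𝓧 × ℝ) (i : Fin N) :
    (fun k => D (σ k)) ∈ A.highResidualSet b i ↔ D ∈ A.highResidualSet b (σ i) := by
  simp only [highResidualSet, Set.mem_ofPred_eq, residual_perm hA]
  rw [Finset.card_equiv σ (t := Finset.univ.filter fun k => A.residual D k < A.residual D (σ i))
    (by simp)]

/-! ### Stability events -/

/-- The data sets of size `n + 1 + m` for which the models fitted to the first `n + 1` points and
to all points differ by more than `ε` at the `k`-th point. -/
def unstableSet (A : RegressionAlgorithm 𝓧) {n m : ℕ} (ε : ℝ) (k : Fin (n + 1)) :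
    Set (Fin (n + 1 + m) → 𝓧 × ℝ) :=
  {D | ε < |A.fit (n + 1) (fun i => D (Fin.castAdd m i)) (D (Fin.castAdd m k)).1
    - A.fit (n + 1 + m) D (D (Fin.castAdd m k)).1|}

theorem measurable_fit_sub_fit (A : RegressionAlgorithm 𝓧) {n m : ℕ} (k : Fin (n + 1)) :
    Measurable fun D : Fin (n + 1 + m) → 𝓧 × ℝ =>
      |A.fit (n + 1) (fun i => D (Fin.castAdd m i)) (D (Fin.castAdd m k)).1
        - A.fit (n + 1 + m) D (D (Fin.castAdd m k)).1| := by
  refine Measurable.abs (Measurable.sub ?_ ?_)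
  · exact A.measurable_fit_comp (by fun_prop) (by fun_prop)
  · exact A.measurable_fit_comp measurable_id (by fun_prop)

theorem measurableSet_unstableSet (A : RegressionAlgorithm 𝓧) {n m : ℕ} (ε : ℝ)
    (k : Fin (n + 1)) : MeasurableSet (A.unstableSet (m := m) ε k) :=
  measurableSet_lt measurable_const (A.measurable_fit_sub_fit k)

/-- The smaller fit sees only the first `n + 1` points, so a permutation has to preserve this block;
`φ` swaps two of its points and fixes the other `m`. -/
theorem exists_measurePreserving_unstableSet {A : RegressionAlgorithm 𝓧} (hA : A.IsSymmetric)
    (P : Measure (𝓧 × ℝ)) [SigmaFinite P] {n m : ℕ} (ε : ℝ) (k k' : Fin (n + 1)) :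
    ∃ φ : (Fin (n + 1 + m) → 𝓧 × ℝ) → (Fin (n + 1 + m) → 𝓧 × ℝ),
      MeasurePreserving φ (Measure.pi fun _ => P) (Measure.pi fun _ => P) ∧
      ∃ σ : Equiv.Perm (Fin (n + 1)), σ k = k' ∧
        ∀ D i, φ D ∈ A.unstableSet ε i ↔ D ∈ A.unstableSet ε (σ i) := by
  let σ : Equiv.Perm (Fin (n + 1)) := Equiv.swap k k'
  let σ' : Equiv.Perm (Fin (n + 1 + m)) :=
    finSumFinEquiv.permCongr (Equiv.sumCongr σ (Equiv.refl _))
  have hσ' : ∀ i, σ' (Fin.castAdd m i) = Fin.castAdd m (σ i) := fun i => by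
    simp [σ', Equiv.permCongr_apply]
  refine ⟨_, measurePreserving_comp_equiv P σ', σ, Equiv.swap_apply_left k k', fun D i => ?_⟩
  have h1 : A.fit (n + 1) (fun i => D (Fin.castAdd m (σ i)))
      = A.fit (n + 1) (fun i => D (Fin.castAdd m i)) :=
    hA (n + 1) σ fun i => D (Fin.castAdd m i)
  simp only [unstableSet, Set.mem_ofPred_eq, hσ', hA (n + 1 + m) σ' D, h1]

/-- The first Markov step. -/
theorem measure_unstableSet_zero_le (A : RegressionAlgorithm 𝓧) (P : Measure (𝓧 × ℝ))
    {n m : ℕ} {ε : ℝ} (hε : 0 < ε) :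
    Measure.pi (fun _ => P) (A.unstableSet (n := n) (m := m) ε 0)
      ≤ inSampleStability A P m (n + 1) / ENNReal.ofReal ε := by
  refine le_trans (measure_mono fun D hD => ?_) (meas_ge_le_lintegral_div
    (A.measurable_fit_sub_fit 0).ennreal_ofReal.aemeasurable (by simpa using hε)
    ENNReal.ofReal_ne_top)
  exact ENNReal.ofReal_le_ofReal (le_of_lt hD)

open scoped Classical in
/-- The data sets for which the model fitted to the first `n + 1` points is unstable at the last
of these, or at more than a fraction `ρ` of them. -/
def unstableTestSet (A : RegressionAlgorithm 𝓧) (n m : ℕ) (ε ρ : ℝ) :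
    Set (Fin (n + 1 + m) → 𝓧 × ℝ) :=
  A.unstableSet ε (Fin.last n) ∪ {D | ρ * Fintype.card (Fin (n + 1)) <
    ((Finset.univ.filter fun k => D ∈ A.unstableSet (n := n) ε k).card : ℝ)}

theorem measurableSet_unstableTestSet (A : RegressionAlgorithm 𝓧) (n m : ℕ) (ε ρ : ℝ) :
    MeasurableSet (A.unstableTestSet n m ε ρ) := by
  classical
  exact measurableSet_union_lt_card_filter _ (A.measurableSet_unstableSet ε) _ _

/-- The permutation that exchanges the first test point and the `j`-th test point. -/
def swapTest (n m : ℕ) (j : Fin (m + 1)) : Equiv.Perm (Fin (n + 1 + m)) :=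
  Equiv.swap (trainTestEquiv n m (.inr 0)) (trainTestEquiv n m (.inr j))

theorem swapTest_train (n m : ℕ) (j : Fin (m + 1)) (k : Fin n) :
    swapTest n m j (Fin.castAdd m k.castSucc) = trainTestEquiv n m (.inl k) := by
  rw [← trainTestEquiv_inl, swapTest, Equiv.swap_apply_of_ne_of_ne] <;> simp

theorem swapTest_last (n m : ℕ) (j : Fin (m + 1)) :
    swapTest n m j (Fin.castAdd m (Fin.last n)) = trainTestEquiv n m (.inr j) := by
  rw [← trainTestEquiv_inr_zero, swapTest, Equiv.swap_apply_left]

/-! ### From miscoverage to ranks in the full data -/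

/-- If a test point is miscovered by the set built from the training data, and the model fitted to
both is stable, then the residual of the test point for the model fitted to all data is large. -/
theorem le_card_residual_lt {A : RegressionAlgorithm 𝓧} (hA : A.IsSymmetric) {α γ ρ : ℝ}
    {n m : ℕ} (D : Fin (n + 1 + m) → 𝓧 × ℝ) (j : Fin (m + 1))
    (hD : (fun k => D (trainTestEquiv n m (.inl k)), D (trainTestEquiv n m (.inr j)))
      ∈ A.miscoveredSet α γ n)
    (hstable : (fun i => D (swapTest n m j i)) ∉ A.unstableTestSet n m (γ / 2) ρ) :
    (1 - α - ρ) * (n + 1) ≤ ((Finset.univ.filter fun k : Fin n =>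
      A.residual D (trainTestEquiv n m (.inl k))
        < A.residual D (trainTestEquiv n m (.inr j))).card : ℝ) := by
  classical
  set tr : Fin n → Fin (n + 1 + m) := fun k => trainTestEquiv n m (.inl k) with htr
  set D' : Fin (n + 1 + m) → 𝓧 × ℝ := fun i => D (swapTest n m j i) with hD'
  set z := D (trainTestEquiv n m (.inr j)) with hz
  have hfirst : (fun i : Fin (n + 1) => D' (Fin.castAdd m i))
      = Fin.snoc (α := fun _ => 𝓧 × ℝ) (fun k => D (tr k)) (z.1, z.2) := by
    funext i
    refine Fin.lastCases ?_ (fun k => ?_) i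
    · simp only [hD', swapTest_last, Fin.snoc_last, hz]
    · simp only [hD', swapTest_train, Fin.snoc_castSucc, htr]
  set f := augmentedModel A (fun k => D (tr k)) z.1 z.2 with hf
  set g := A.fit (n + 1 + m) D with hg
  have hfit : A.fit (n + 1 + m) D' = g := hA _ _ _
  have hun : ∀ k : Fin (n + 1), D' ∈ A.unstableSet (γ / 2) k ↔
      γ / 2 < |f (D' (Fin.castAdd m k)).1 - g (D' (Fin.castAdd m k)).1| := fun k => by
    simp only [unstableSet, Set.mem_ofPred_eq, hfirst, hfit]
    rfl
  simp only [unstableTestSet, Set.mem_union, not_or, Set.mem_ofPred_eq, not_lt,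
    Fintype.card_fin] at hstable
  obtain ⟨hlast, hcount⟩ := hstable
  rw [hun, not_lt, show D' (Fin.castAdd m (Fin.last n)) = z by
    simp only [hD', swapTest_last, hz]] at hlast
  have htrain : ∀ k : Fin n, D' (Fin.castAdd m k.castSucc) = D (tr k) := fun k => by
    simp only [hD', swapTest_train, htr]
  set S := Finset.univ.filter fun k : Fin n =>
    |(D (tr k)).2 - f (D (tr k)).1| + γ < |z.2 - f z.1| with hS
  set L := Finset.univ.filter fun k : Fin n =>
    A.residual D (tr k) < A.residual D (trainTestEquiv n m (.inr j)) with hL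
  set U := Finset.univ.filter fun k : Fin n => D' ∈ A.unstableSet (γ / 2) k.castSucc with hU
  have hSle : (1 - α) * (n + 1) ≤ (S.card : ℝ) := hD
  -- The inflation `γ` pays for two model changes of at most `γ / 2`, one at the test point and one
  -- at the training point.
  have hsub : S ⊆ L ∪ U := by
    intro k hk
    by_contra hcon
    simp only [hL, hU, Finset.mem_union, Finset.mem_filter, Finset.mem_univ, true_and, not_or,
      hun, htrain, not_lt] at hcon
    have h1 := (Finset.mem_filter.1 hk).2
    obtain ⟨h2, h3⟩ := hcon
    have h2' : |z.2 - g z.1| ≤ |(D (tr k)).2 - g (D (tr k)).1| := h2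
    have h4 := abs_sub_le z.2 (g z.1) (f z.1)
    have h5 := abs_sub_le (D (tr k)).2 (f (D (tr k)).1) (g (D (tr k)).1)
    rw [abs_sub_comm] at hlast
    linarith
  have hUle : U.card ≤ (Finset.univ.filter fun k => D' ∈ A.unstableSet (n := n) (γ / 2) k).card :=
    Finset.card_le_card_of_injOn Fin.castSucc
      (fun k hk => by simpa [hU] using hk) (Fin.castSucc_injective n).injOn
  have h1 : S.card ≤ L.card + U.card :=
    (Finset.card_le_card hsub).trans (Finset.card_union_le _ _)
  have h1' : (S.card : ℝ) ≤ L.card + U.card := by exact_mod_cast h1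
  have h2' : (U.card : ℝ) ≤ ρ * (n + 1) := by
    refine le_trans ?_ (hcount.trans_eq (by push_cast; ring))
    convert (Nat.cast_le (α := ℝ)).2 hUle
  linarith

-- Swapping test points preserves the product law, so each test point is bad with the same
-- probability, and the second Markov step bounds it by `ρ ^ 2`.
open scoped Classical in
theorem measure_lt_card_unstable_le {A : RegressionAlgorithm 𝓧} (hA : A.IsSymmetric)
    (P : Measure (𝓧 × ℝ)) [IsProbabilityMeasure P] {n m : ℕ} {γ ρ : ℝ} (hγ : 0 < γ) (hρ0 : 0 ≤ ρ)
    (hρ1 : ρ ≤ 1)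
    (hβ : inSampleStability A P m (n + 1) / ENNReal.ofReal (γ / 2) ≤ ENNReal.ofReal (ρ ^ 3)) :
    Measure.pi (fun _ => P) {D | ρ * Fintype.card (Fin (m + 1)) <
      ((Finset.univ.filter fun j => D ∈
        (fun (D : Fin (n + 1 + m) → 𝓧 × ℝ) i => D (swapTest n m j i)) ⁻¹'
          A.unstableTestSet n m (γ / 2) ρ).card : ℝ)} ≤ ENNReal.ofReal ρ := by
  have hmeas := A.measurableSet_unstableTestSet n m (γ / 2) ρ
  refine measure_lt_card_filter_le_ofReal _ (fun j =>
    (measurePreserving_comp_equiv P (swapTest n m j)).measurable hmeas) hρ0 fun j => ?_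
  rw [(measurePreserving_comp_equiv P (swapTest n m j)).measure_preimage hmeas.nullMeasurableSet]
  refine measure_union_lt_card_filter_le_ofReal _ (A.measurableSet_unstableSet (γ / 2))
    (exists_measurePreserving_unstableSet hA P (γ / 2)) hρ0 hρ1 _ ?_
  -- Stability is defined at point `0`, but the test point occupies the last of the `n + 1` places;
  -- exchangeability identifies the two probabilities.
  refine le_trans ?_ ((A.measure_unstableSet_zero_le P (half_pos hγ)).trans hβ)
  obtain ⟨φ, hφ, σ, hσ, hGσ⟩ :=
    exists_measurePreserving_unstableSet (m := m) hA P (γ / 2) 0 (Fin.last n)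
  have h1 : φ ⁻¹' A.unstableSet (γ / 2) 0 = A.unstableSet (γ / 2) (Fin.last n) := by
    ext D
    rw [Set.mem_preimage, hGσ, hσ]
  rw [← h1, hφ.measure_preimage (A.measurableSet_unstableSet _ _).nullMeasurableSet]

/-- Away from the deviation events, the probability of miscoverage is small. -/
theorem miscoveredSet_real_lt {A : RegressionAlgorithm 𝓧} (hA : A.IsSymmetric)
    {P : Measure (𝓧 × ℝ)} [IsProbabilityMeasure P] {α γ ρ t : ℝ} {n m : ℕ}
    [DecidablePred fun q => q ∈ A.miscoveredSet α γ n]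
    [∀ b D, DecidablePred fun i => D ∈ A.lowResidualSet (N := n + 1 + m) b i]
    [∀ b D, DecidablePred fun i => D ∈ A.highResidualSet (N := n + 1 + m) b i]
    [∀ D, DecidablePred fun j => D ∈
        (fun (D : Fin (n + 1 + m) → 𝓧 × ℝ) i => D (swapTest n m j i)) ⁻¹'
          A.unstableTestSet n m (γ / 2) ρ]
    (D : Fin (n + 1 + m) → 𝓧 × ℝ) (ha : 0 ≤ 1 - α - ρ)
    (hiid : ¬ (P.real {z | (fun k => D (trainTestEquiv n m (.inl k)), z)
            ∉ A.miscoveredSet α γ n} + t) * Fintype.card (Fin (m + 1))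
        ≤ ((Finset.univ.filter fun j => (fun k => D (trainTestEquiv n m (.inl k)),
            D (trainTestEquiv n m (.inr j))) ∉ A.miscoveredSet α γ n).card : ℝ))
    (hlow : ¬ (1 - α - ρ - t + t) * Fintype.card (Fin n) ≤ ((Finset.univ.filter fun k =>
      D ∈ A.lowResidualSet ((1 - α - ρ - t) * (n + 1 + m : ℕ))
        (trainTestEquiv n m (.inl k))).card : ℝ))
    (hhigh : ¬ (α + ρ + t + t) * Fintype.card (Fin (m + 1)) ≤ ((Finset.univ.filter fun j =>
      D ∈ A.highResidualSet ((1 - α - ρ - t) * (n + 1 + m : ℕ))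
        (trainTestEquiv n m (.inr j))).card : ℝ))
    (hstable : ¬ ρ * Fintype.card (Fin (m + 1)) <
      ((Finset.univ.filter fun j => D ∈
        (fun (D : Fin (n + 1 + m) → 𝓧 × ℝ) i => D (swapTest n m j i)) ⁻¹'
          A.unstableTestSet n m (γ / 2) ρ).card : ℝ))
    (hM : MeasurableSet (A.miscoveredSet α γ n)) :
    P.real {z | (fun k => D (trainTestEquiv n m (.inl k)), z) ∈ A.miscoveredSet α γ n}
      < α + 3 * t + 2 * ρ := by
  classical
  set b := (1 - α - ρ - t) * (n + 1 + m : ℕ) with hb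
  set d : Fin n → 𝓧 × ℝ := fun k => D (trainTestEquiv n m (.inl k)) with hd
  set S := Finset.univ.filter fun j => (d, D (trainTestEquiv n m (.inr j))) ∈ A.miscoveredSet α γ n with hS
  set H := Finset.univ.filter fun j =>
      D ∈ A.highResidualSet b (trainTestEquiv n m (.inr j)) with hH
  set U := Finset.univ.filter fun j => D ∈
        (fun (D : Fin (n + 1 + m) → 𝓧 × ℝ) i => D (swapTest n m j i)) ⁻¹'
          A.unstableTestSet n m (γ / 2) ρ with hU
  have hcompl : P.real {z | (d, z) ∉ A.miscoveredSet α γ n} = 1 - P.real {z | (d, z) ∈ A.miscoveredSet α γ n} :=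
    probReal_compl_eq_one_sub (measurable_prodMk_left hM)
  have hcard : S.card + (Finset.univ.filter fun j =>
      (d, D (trainTestEquiv n m (.inr j))) ∉ A.miscoveredSet α γ n).card = m + 1 := by
    have := Finset.card_filter_add_card_filter_not (s := (Finset.univ : Finset (Fin (m + 1))))
      (fun j => (d, D (trainTestEquiv n m (.inr j))) ∈ A.miscoveredSet α γ n)
    simpa using this
  have hcard' : (S.card : ℝ) + (Finset.univ.filter fun j =>
      (d, D (trainTestEquiv n m (.inr j))) ∉ A.miscoveredSet α γ n).card = m + 1 := by exact_mod_cast hcard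
  have hsub : S ⊆ U ∪ H := by
    intro j hj
    by_contra hcon
    simp only [hU, hH, Finset.mem_union, Finset.mem_filter, Finset.mem_univ, true_and,
      not_or] at hcon
    obtain ⟨hj1, hj2⟩ := hcon
    have hsel := le_card_residual_lt hA D j (Finset.mem_filter.1 hj).2 hj1
    -- Pigeonhole: more training residuals lie below that of the test point than there are training
    -- points of low rank.
    have hex : ∃ k : Fin n, A.residual D (trainTestEquiv n m (.inl k))
        < A.residual D (trainTestEquiv n m (.inr j)) ∧
        D ∉ A.lowResidualSet b (trainTestEquiv n m (.inl k)) := by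
      by_contra hno
      push Not at hno
      apply hlow
      rw [Fintype.card_fin, sub_add_cancel]
      have h1 : (1 - α - ρ) * (n : ℝ) ≤ (1 - α - ρ) * (n + 1) := by
        gcongr
        linarith
      refine h1.trans (hsel.trans ?_)
      norm_cast
      refine Finset.card_le_card fun k hk => ?_
      simp only [Finset.mem_filter, Finset.mem_univ, true_and] at hk ⊢
      exact hno k hk
    obtain ⟨k, hk1, hk2⟩ := hex
    apply hj2
    simp only [lowResidualSet, highResidualSet, Set.mem_ofPred_eq, not_lt] at hk2 ⊢
    refine hk2.trans ?_
    norm_cast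
    refine Finset.card_le_card fun i hi => ?_
    simp only [Finset.mem_filter, Finset.mem_univ, true_and] at hi ⊢
    exact hi.trans_lt hk1
  have hle : (S.card : ℝ) ≤ U.card + H.card := by
    exact_mod_cast (Finset.card_le_card hsub).trans (Finset.card_union_le _ _)
  rw [Fintype.card_fin, not_le] at hiid hhigh
  rw [Fintype.card_fin, not_lt] at hstable
  rw [hcompl] at hiid
  push_cast at hiid hhigh hstable
  have hm : (0 : ℝ) < m + 1 := by positivity
  -- One `t` each comes from the rank threshold `b`, the count of high ranks and the i.i.d. test
  -- points; one `ρ` each from the unstable training points and the bad test points.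
  have key : P.real {z | (d, z) ∈ A.miscoveredSet α γ n} * (m + 1) < (α + 3 * t + 2 * ρ) * (m + 1) := by
    linarith
  exact lt_of_mul_lt_mul_right key hm.le

theorem measure_le_miscoveredSet_real {A : RegressionAlgorithm 𝓧} (hA : A.IsSymmetric)
    (P : Measure (𝓧 × ℝ)) [IsProbabilityMeasure P] {α γ ρ t η : ℝ} {n m : ℕ}
    (hα0 : 0 ≤ α) (hγ : 0 < γ) (hρ0 : 0 ≤ ρ) (hρ1 : ρ ≤ 1) (ht : 0 < t)
    (hβ : inSampleStability A P m (n + 1) / ENNReal.ofReal (γ / 2) ≤ ENNReal.ofReal (ρ ^ 3))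
    (hn : Real.exp (-(2 * n * t ^ 2)) ≤ η)
    (hm : Real.exp (-(2 * (m + 1) * t ^ 2)) ≤ η) :
    Measure.pi (fun _ : Fin n => P) {d | α + 3 * t + 2 * ρ
        ≤ P.real {z | (d, z) ∈ A.miscoveredSet α γ n}}
      ≤ ENNReal.ofReal (3 * η) + ENNReal.ofReal ρ := by
  classical
  -- In the first case `α + 3 * t + 2 * ρ` exceeds `1`, so the event is empty.
  rcases le_or_gt (1 - α - ρ - t) 0 with ha | ha
  · have : {d | α + 3 * t + 2 * ρ ≤ P.real {z | (d, z) ∈ A.miscoveredSet α γ n}} = ∅ := by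
      refine Set.eq_empty_of_forall_notMem fun d hd => ?_
      have h1 : P.real {z | (d, z) ∈ A.miscoveredSet α γ n} ≤ 1 := measureReal_le_one
      have h2 : α + 3 * t + 2 * ρ ≤ P.real {z | (d, z) ∈ A.miscoveredSet α γ n} := hd
      linarith
    rw [this, measure_empty]
    exact zero_le
  -- The fraction is lowered by `t` so that a deviation of `t` among the training points ends
  -- exactly at `1 - α - ρ`.
  set b : ℝ := (1 - α - ρ - t) * (n + 1 + m : ℕ) with hb
  have hM := A.measurableSet_miscoveredSet α γ n
  let e := trainTestEquiv n m
  let fl : Fin n ↪ Fin (n + 1 + m) := ⟨fun k => e (.inl k), fun _ _ h => by simpa using h⟩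
  let fr : Fin (m + 1) ↪ Fin (n + 1 + m) := ⟨fun k => e (.inr k), fun _ _ h => by simpa using h⟩
  have hsplit := measurePreserving_split P e
  have hiid := measure_prod_card_filter_ge_le (κ := Fin (m + 1))
    (Measure.pi fun _ : Fin n => P) P _ hM ht.le
  have hb0 : 0 ≤ b := by positivity
  have hlow := measure_card_filter_embedding_ge_le P (A.lowResidualSet b) fl
    (A.measurableSet_lowResidualSet b) (perm_mem_lowResidualSet hA b) (p := 1 - α - ρ - t)
    ha.le (by linarith) ht.le fun D => by
      rw [Fintype.card_fin]
      exact card_filter_card_le_lt_le (A.residual D) hb0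
  have hbN : b ≤ (n + 1 + m : ℕ) :=
    mul_le_of_le_one_left (Nat.cast_nonneg _) (by linarith)
  have hhigh := measure_card_filter_embedding_ge_le P (A.highResidualSet b) fr
    (A.measurableSet_highResidualSet b) (perm_mem_highResidualSet hA b) (p := α + ρ + t)
    (by linarith) (by linarith) ht.le fun D => by
      have h := card_filter_le_card_lt_le (A.residual D) (b := b) (by simpa using hbN)
      refine h.trans_eq ?_
      rw [Fintype.card_fin, hb]
      ring
  have hstable := measure_lt_card_unstable_le hA P hγ hρ0 hρ1 hβ
  have hmeas : MeasurableSet {d : Fin n → 𝓧 × ℝ | α + 3 * t + 2 * ρ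
      ≤ P.real {z | (d, z) ∈ A.miscoveredSet α γ n}} :=
    measurableSet_le measurable_const (measurable_measure_prodMk_left hM).ennreal_toReal
  have hfst : MeasurePreserving (fun (D : Fin (n + 1 + m) → 𝓧 × ℝ) k => D (e (.inl k)))
      (Measure.pi fun _ => P) (Measure.pi fun _ => P) :=
    measurePreserving_fst.comp hsplit
  have hδ : ∀ {c : ℝ}, Real.exp (-c) ≤ η → ENNReal.ofReal (Real.exp (-c)) ≤ ENNReal.ofReal η :=
    fun h => ENNReal.ofReal_le_ofReal h
  have hη : 0 ≤ η := (Real.exp_pos _).le.trans hn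
  rw [← hfst.measure_preimage hmeas.nullMeasurableSet]
  set E₁ := {q : (Fin n → 𝓧 × ℝ) × (Fin (m + 1) → 𝓧 × ℝ) |
    (P.real {z | (q.1, z) ∉ A.miscoveredSet α γ n} + t) * Fintype.card (Fin (m + 1))
      ≤ ((Finset.univ.filter fun j => (q.1, q.2 j) ∉ A.miscoveredSet α γ n).card : ℝ)} with hE₁
  set E₂ := {D : Fin (n + 1 + m) → 𝓧 × ℝ | (1 - α - ρ - t + t) * Fintype.card (Fin n)
    ≤ ((Finset.univ.filter fun k => D ∈ A.lowResidualSet b (fl k)).card : ℝ)} with hE₂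
  set E₃ := {D : Fin (n + 1 + m) → 𝓧 × ℝ | (α + ρ + t + t) * Fintype.card (Fin (m + 1))
    ≤ ((Finset.univ.filter fun k => D ∈ A.highResidualSet b (fr k)).card : ℝ)} with hE₃
  set E₄ := {D : Fin (n + 1 + m) → 𝓧 × ℝ | ρ * Fintype.card (Fin (m + 1)) <
    ((Finset.univ.filter fun j => D ∈
      (fun (D : Fin (n + 1 + m) → 𝓧 × ℝ) i => D (swapTest n m j i)) ⁻¹'
        A.unstableTestSet n m (γ / 2) ρ).card : ℝ)} with hE₄
  have hE₁' : Measure.pi (fun _ => P)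
      ((fun D : Fin (n + 1 + m) → 𝓧 × ℝ => (fun k => D (e (.inl k)), fun j => D (e (.inr j)))) ⁻¹'
        E₁) ≤ ENNReal.ofReal η :=
    (hsplit.measure_preimage_le _).trans (hiid.trans (hδ (by simpa using hm)))
  have hE₂' := hlow.trans (hδ (by simpa using hn))
  have hE₃' := hhigh.trans (hδ (by simpa using hm))
  have hsum : ENNReal.ofReal (3 * η) + ENNReal.ofReal ρ
      = ENNReal.ofReal η + (ENNReal.ofReal η + (ENNReal.ofReal η + ENNReal.ofReal ρ)) := by
    rw [show 3 * η = η + (η + η) by ring, ENNReal.ofReal_add hη (by positivity),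
      ENNReal.ofReal_add hη hη]
    ring
  rw [hsum]
  refine le_trans (measure_mono (t := ((fun D : Fin (n + 1 + m) → 𝓧 × ℝ =>
    (fun k => D (e (.inl k)), fun j => D (e (.inr j)))) ⁻¹' E₁) ∪ (E₂ ∪ (E₃ ∪ E₄))) ?_)
    ((measure_union_le _ _).trans (add_le_add hE₁' ((measure_union_le _ _).trans
      (add_le_add hE₂' ((measure_union_le _ _).trans (add_le_add hE₃' hstable))))))
  intro D hD
  by_contra hcon
  simp only [Set.mem_union, not_or] at hcon
  obtain ⟨h1, h2, h3, h4⟩ := hcon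
  exact absurd (miscoveredSet_real_lt hA D (by linarith) h1 h2 h3 h4 hM) (not_lt.2 hD)

end RegressionAlgorithm

/-! ### The theorem in extended nonnegative reals -/

theorem theorem3 {𝓧 : Type*} [MeasurableSpace 𝓧]
    (P : Measure (𝓧 × ℝ)) [IsProbabilityMeasure P]
    (A : RegressionAlgorithm 𝓧) (hA : A.IsSymmetric)
    (α : ℝ) (hα0 : 0 ≤ α) (hα1 : α ≤ 1)
    (n : ℕ) (hn : 1 ≤ n) (γ : ℝ) (hγ : 0 < γ)
    (m : ℕ) (hm : 1 ≤ m) (δ : ℝ) (hδ0 : 0 < δ) (hδ1 : δ < 1) :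
    (Measure.pi fun _ : Fin n => P)
        {D : Fin n → 𝓧 × ℝ | miscoverage A P α γ D <
          ENNReal.ofReal (α + 3 * Real.sqrt (Real.log (1 / δ) / (2 * min (n : ℝ) (m : ℝ))))
            + 2 * (2 * inSampleStability A P (m - 1) (n + 1) / ENNReal.ofReal γ) ^ (1 / 3 : ℝ)} ≥
      1 - ENNReal.ofReal (3 * δ)
        - (2 * inSampleStability A P (m - 1) (n + 1) / ENNReal.ofReal γ) ^ (1 / 3 : ℝ) := by
  -- The first test point joins the training data in the smaller fit, so only `m - 1` points are
  -- added to reach the full one.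
  obtain ⟨m, rfl⟩ : ∃ m', m = m' + 1 := ⟨m - 1, by omega⟩
  rw [Nat.add_sub_cancel]
  set y := 2 * inSampleStability A P m (n + 1) / ENNReal.ofReal γ with hy
  set x := y ^ (1 / 3 : ℝ) with hx
  set t := Real.sqrt (Real.log (1 / δ) / (2 * min (n : ℝ) ((m + 1 : ℕ) : ℝ))) with ht
  -- For `1 ≤ x`, which includes infinite `x`, the truncated lower bound is `0`.
  rcases le_or_gt 1 x with hx1 | hx1
  · rw [tsub_eq_zero_of_le (tsub_le_self.trans hx1)]
    exact zero_le
  have hxtop : x ≠ ⊤ := (hx1.trans ENNReal.one_lt_top).ne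
  set ρ := x.toReal with hρ
  have hxρ : x = ENNReal.ofReal ρ := (ENNReal.ofReal_toReal hxtop).symm
  have hρ0 : 0 ≤ ρ := ENNReal.toReal_nonneg
  have hρ1 : ρ ≤ 1 := by
    rw [hxρ, ENNReal.ofReal_lt_one] at hx1
    exact hx1.le
  have hlog : 0 < Real.log (1 / δ) := Real.log_pos (by rw [one_lt_div hδ0]; exact hδ1)
  have hmin : (0 : ℝ) < min (n : ℝ) ((m + 1 : ℕ) : ℝ) :=
    lt_min (by exact_mod_cast hn) (by positivity)
  have ht0 : 0 < t := Real.sqrt_pos.2 (by positivity)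
  have ht2 : 2 * min (n : ℝ) ((m + 1 : ℕ) : ℝ) * t ^ 2 = Real.log (1 / δ) := by
    rw [ht, Real.sq_sqrt (by positivity)]
    field_simp
  have hexp : ∀ c : ℝ, min (n : ℝ) ((m + 1 : ℕ) : ℝ) ≤ c → Real.exp (-(2 * c * t ^ 2)) ≤ δ := by
    intro c hc
    have h1 : Real.log (1 / δ) ≤ 2 * c * t ^ 2 := by
      rw [← ht2]
      gcongr
    calc Real.exp (-(2 * c * t ^ 2)) ≤ Real.exp (-Real.log (1 / δ)) :=
          Real.exp_le_exp.2 (neg_le_neg h1)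
      _ = δ := by rw [one_div, Real.log_inv, neg_neg, Real.exp_log hδ0]
  have hβ : inSampleStability A P m (n + 1) / ENNReal.ofReal (γ / 2) ≤ ENNReal.ofReal (ρ ^ 3) := by
    have e1 : inSampleStability A P m (n + 1) / ENNReal.ofReal (γ / 2) = y := by
      rw [hy, ENNReal.ofReal_div_of_pos two_pos, ENNReal.ofReal_ofNat, div_eq_mul_inv,
        ENNReal.inv_div (by simp) (by simp), div_eq_mul_inv, div_eq_mul_inv]
      ring
    have e2 : y = x ^ (3 : ℕ) := by
      rw [hx, ← ENNReal.rpow_natCast, ← ENNReal.rpow_mul]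
      norm_num
    rw [e1, e2, hxρ, ENNReal.ofReal_pow hρ0]
  have hmain := RegressionAlgorithm.measure_le_miscoveredSet_real hA P (n := n) (m := m)
    hα0 hγ hρ0 hρ1 ht0 hβ (hexp n (min_le_left _ _))
    (by simpa using hexp ((m + 1 : ℕ) : ℝ) (min_le_right _ _))
  have hT : ENNReal.ofReal (α + 3 * t) + 2 * x = ENNReal.ofReal (α + 3 * t + 2 * ρ) := by
    rw [ENNReal.ofReal_add (p := α + 3 * t) (by positivity) (by positivity), ENNReal.ofReal_mul two_pos.le,
      ENNReal.ofReal_ofNat, hxρ]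
  rw [hT]
  set S := {D : Fin n → 𝓧 × ℝ | miscoverage A P α γ D < ENNReal.ofReal (α + 3 * t + 2 * ρ)}
    with hS
  have hcompl : (Measure.pi fun _ : Fin n => P) Sᶜ ≤ ENNReal.ofReal (3 * δ) + x := by
    rw [hxρ]
    refine (measure_mono fun D hD => ?_).trans hmain
    have h1 : ENNReal.ofReal (α + 3 * t + 2 * ρ) ≤ miscoverage A P α γ D := not_lt.1 hD
    -- Monotonicity of outer measure suffices; only the larger set needs to be measurable.
    have h2 : miscoverage A P α γ D ≤ P {z | (D, z) ∈ A.miscoveredSet α γ n} :=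
      measure_mono fun z hz => A.mem_miscoveredSet_of_notMem_conformalSet hn hz
    exact (ENNReal.ofReal_le_iff_le_toReal (measure_ne_top _ _)).1 (h1.trans h2)
  have huniv : 1 ≤ (Measure.pi fun _ : Fin n => P) S + (ENNReal.ofReal (3 * δ) + x) := by
    calc (1 : ℝ≥0∞) = (Measure.pi fun _ : Fin n => P) (S ∪ Sᶜ) := by
          rw [Set.union_compl_self, measure_univ]
      _ ≤ _ := (measure_union_le _ _).trans (by gcongr)
  rw [ge_iff_le, tsub_tsub]
  exact tsub_le_iff_right.2 huniv
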